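/- Let $n\ge 3$ and let $u$ denote a scalar function of the independent variables $x^1,\dots,x^n$, with partial derivatives $u_i=\partial u/\partial x^i$, $u_{ij}=\partial^2u/\partial x^i\partial x^j$, etc. Let $L_{ij}=-L_{ji}$ $(1\le i,j\le n)$ be smooth functions of $x^1,\dots,x^n$, $u$ and the first and second derivatives $u_k$, $u_{kl}$ in all directions, defined on an open set of the second jet space, and consider the Lagrangian 2-form $$\mathcal L=\sum_{i<j}L_{ij}\,dx^i\wedge dx^j .$$ Suppose that the exterior derivative of $\mathcal L$ factorises, identically for arbitrary smooth $u$, as $$d\mathcal L=\sum_{i<j<k}A_{ijk}B_{ijk}\,dx^i\wedge dx^j\wedge dx^k ,$$ where $A_{ijk}$, $B_{ijk}$ are smooth functions of $x^1,\dots,x^n$, $u$ and finitely many partial derivatives of $u$, defined on an open set of a jet space of finite order. Then every smooth solution $u$ (on an open set of $\mathbb R^n$, with jets in the above domains) of the system $$A_{ijk}=0,\qquad B_{ijk}=0\qquad (i<j<k)$$ satisfies the full system of multiform Euler–Lagrange equations: for all pairwise distinct $i,j,k$, $$\frac{\delta_{ij}L_{ij}}{\delta u}=0,\qquad \frac{\delta_{ij}L_{ij}}{\delta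 u_j}-\frac{\delta_{ik}L_{ik}}{\delta u_k}=0,\qquad \frac{\delta_{ij}L_{ij}}{\delta u_{ij}}+\frac{\delta_{jk}L_{jk}}{\delta u_{jk}}+\frac{\delta_{ki}L_{ki}}{\delta u_{ki}}=0$$ (planar, edge and corner equations), together with $$\frac{\delta_{ij}L_{ij}}{\delta u_k}=0\quad(k\ne i,j),\qquad \frac{\partial L_{ij}}{\partial u_{kl}}=0\quad(k,l\neq i,j),\qquad \frac{\partial L_{ij}}{\partial u_{jl}}-\frac{\partial L_{ik}}{\partial u_{kl}}=0\quad(l\ne i).$$ Here $\partial_i=\partial/\partial x^i$ acts on expressions evaluated on $u$, and, for $i\ne j$ and $F$ depending on derivatives of order at most two, $$\frac{\delta_{ij}F}{\delta u}=\frac{\partial F}{\partial u}-\partial_i\frac{\partial F}{\partial u_i}-\partial_j\frac{\partial F}{\partial u_j}+\partial_i^2\frac{\partial F}{\partial u_{ii}}+\partial_i\partial_j\frac{\partial F}{\partial u_{ij}}+\partial_j^2\frac{\partial F}{\partial u_{jj}},$$ $$\frac{\delta_{ij}F}{\delta u_k}=\frac{\partial F}{\partial u_k}-\partial_i\frac{\partial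 F}{\partial u_{ik}}-\partial_j\frac{\partial F}{\partial u_{jk}}\quad(k\text{ arbitrary}),\qquad \frac{\delta_{ij}F}{\delta u_{kl}}=\frac{\partial F}{\partial u_{kl}} .$$ -/

import Mathlib

open scoped ContDiff

noncomputable section

namespace LagrangianMultiform

/-- The space of the independent variables `x¹, …, xⁿ`. -/
abbrev Base (n : ℕ) : Type := Fin n → ℝ

/-- Multi-indices of order at most `k`: finite multisets of indices, so that `{i, j}` is the
multi-index of `u_{ij} = u_{ji}`. -/
abbrev MultiIndex (n k : ℕ) : Type := {I : Multiset (Fin n) // Multiset.card I ≤ k}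

instance instFiniteMultiIndex (n k : ℕ) : Finite (MultiIndex n k) := by
  let f : MultiIndex n k → (Σ m : Fin (k + 1), Sym (Fin n) m) :=
    fun I => ⟨⟨Multiset.card I.1, Nat.lt_succ_of_le I.2⟩, ⟨I.1, rfl⟩⟩
  let g : (Σ m : Fin (k + 1), Sym (Fin n) m) → Multiset (Fin n) := fun s => s.2.1
  have hgf : ∀ I, g (f I) = I.1 := fun _ => rfl
  exact Finite.of_injective f fun I J h => Subtype.ext (by rw [← hgf I, ← hgf J, h])

instance instFintypeMultiIndex (n k : ℕ) : Fintype (MultiIndex n k) := Fintype.ofFinite _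

/-- The jet space of order `k` of scalar functions of `n` variables, with coordinates `x^i` and
`u_I`, where `I` runs through the multi-indices of order at most `k`. -/
abbrev Jet (n k : ℕ) : Type := Base n × (MultiIndex n k → ℝ)

/-- The partial derivative `∂_i f = ∂f/∂x^i` of a function of the independent variables. -/
def pd {n : ℕ} (i : Fin n) (f : Base n → ℝ) (x : Base n) : ℝ :=
  fderiv ℝ f x (Pi.single i 1)

/-- The iterated partial derivative `∂_I f`, taken in the increasing order of the indices in `I`
(the order is immaterial for smooth functions). -/
def pdMulti {n : ℕ} (I : Multiset (Fin n)) (f : Base n → ℝ) : Base n → ℝ :=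
  (I.sort (· ≤ ·)).foldr pd f

/-- The `k`-jet of `u` at `x`. -/
def jet {n : ℕ} (k : ℕ) (u : Base n → ℝ) (x : Base n) : Jet n k :=
  (x, fun I => pdMulti I.1 u x)

/-- The partial derivative `∂F/∂u_I` of a function `F` on the jet space of order `k`; it is zero
if the order of `I` exceeds `k`. -/
def jetPd {n k : ℕ} (I : Multiset (Fin n)) (F : Jet n k → ℝ) (p : Jet n k) : ℝ :=
  if h : Multiset.card I ≤ k then fderiv ℝ F p (0, Pi.single ⟨I, h⟩ 1) else 0

/-- `(∂F/∂u_I)[u]`: the partial derivative `∂F/∂u_I` along the jet of `u`, as a function of the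
independent variables. -/
def jetPdAlong {n k : ℕ} (I : Multiset (Fin n)) (F : Jet n k → ℝ) (u : Base n → ℝ)
    (x : Base n) : ℝ :=
  jetPd I F (jet k u x)

/-- The `k`-form `dx^{s 0} ∧ ⋯ ∧ dx^{s (k-1)}`. -/
def dxWedge {n k : ℕ} (s : Fin k → Fin n) : Base n [⋀^Fin k]→L[ℝ] ℝ :=
  ContinuousMultilinearMap.alternatization
    ((ContinuousMultilinearMap.mkPiAlgebra ℝ (Fin k) ℝ).compContinuousLinearMap
      fun a => (ContinuousLinearMap.proj (s a) : Base n →L[ℝ] ℝ))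

/-- The Lagrangian 2-form `𝓛[u] = ∑_{i<j} L_{ij}[u] dx^i ∧ dx^j`, a differential 2-form in the
independent variables for each function `u`. -/
def lagrangianForm {n : ℕ} (L : Fin n → Fin n → Jet n 2 → ℝ) (u : Base n → ℝ) (x : Base n) :
    Base n [⋀^Fin 2]→L[ℝ] ℝ :=
  ∑ i : Fin n, ∑ j : Fin n, if i < j then L i j (jet 2 u x) • dxWedge ![i, j] else 0

/-- The exterior derivative of the Lagrangian 2-form with coefficients `L` (defined on `U`)
factorises as `d𝓛 = ∑_{i<j<k} A_{ijk} B_{ijk} dx^i ∧ dx^j ∧ dx^k`, with `A_{ijk}` and `B_{ijk}`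
functions (defined on `W`) on the jet space of order `m`. This is an identity between differential
expressions: it holds for an arbitrary smooth local function `f`, not only on solutions. -/
def Factorises {n m : ℕ} (U : Set (Jet n 2)) (W : Set (Jet n m))
    (L : Fin n → Fin n → Jet n 2 → ℝ) (A B : Fin n → Fin n → Fin n → Jet n m → ℝ) : Prop :=
  ∀ (O : Set (Base n)) (f : Base n → ℝ), IsOpen O → ContDiffOn ℝ ∞ f O →
    ∀ x ∈ O, jet 2 f x ∈ U → jet m f x ∈ W →
      extDeriv (lagrangianForm L f) x =
        ∑ i : Fin n, ∑ j : Fin n, ∑ k : Fin n,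
          if i < j ∧ j < k then
            (A i j k (jet m f x) * B i j k (jet m f x)) • dxWedge ![i, j, k]
          else 0

/-- The variational derivative `δ_{ij}F/δu`, along `u`, of a function `F` on the second jet space:
`∂F/∂u - ∂_i ∂F/∂u_i - ∂_j ∂F/∂u_j + ∂_i∂_i ∂F/∂u_{ii} + ∂_i∂_j ∂F/∂u_{ij} + ∂_j∂_j ∂F/∂u_{jj}`,
for `i ≠ j`. -/
def varDeriv₀ {n : ℕ} (i j : Fin n) (F : Jet n 2 → ℝ) (u : Base n → ℝ) (x : Base n) : ℝ :=
  jetPdAlong 0 F u x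
    - pd i (jetPdAlong {i} F u) x
    - pd j (jetPdAlong {j} F u) x
    + pd i (pd i (jetPdAlong {i, i} F u)) x
    + pd i (pd j (jetPdAlong {i, j} F u)) x
    + pd j (pd j (jetPdAlong {j, j} F u)) x

/-- The variational derivative
`δ_{ij}F/δu_k = ∂F/∂u_k - ∂_i ∂F/∂u_{ik} - ∂_j ∂F/∂u_{jk}`, along `u`, for `i ≠ j` and any `k`
(`k = i` and `k = j` included). -/
def varDeriv₁ {n : ℕ} (i j k : Fin n) (F : Jet n 2 → ℝ) (u : Base n → ℝ) (x : Base n) : ℝ :=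
  jetPdAlong {k} F u x
    - pd i (jetPdAlong {i, k} F u) x
    - pd j (jetPdAlong {j, k} F u) x

/-- The variational derivative `δ_{ij}F/δu_{kl} = ∂F/∂u_{kl}`, along `u`. It does not depend on
`i, j` because `F` is a function on the second jet space. -/
def varDeriv₂ {n : ℕ} (_i _j k l : Fin n) (F : Jet n 2 → ℝ) (u : Base n → ℝ) (x : Base n) : ℝ :=
  jetPdAlong {k, l} F u x

/-- The full system of multiform Euler–Lagrange equations for the function `u` at the point `x`. -/
structure MultiformEulerLagrangeAt {n : ℕ} (L : Fin n → Fin n → Jet n 2 → ℝ)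
    (u : Base n → ℝ) (x : Base n) : Prop where
  /-- Planar equations. -/
  planar : ∀ i j, i ≠ j → varDeriv₀ i j (L i j) u x = 0
  /-- Edge equations. -/
  edge : ∀ i j k, i ≠ j → j ≠ k → k ≠ i →
    varDeriv₁ i j j (L i j) u x - varDeriv₁ i k k (L i k) u x = 0
  /-- Corner equations. -/
  corner : ∀ i j k, i ≠ j → j ≠ k → k ≠ i →
    varDeriv₂ i j i j (L i j) u x + varDeriv₂ j k j k (L j k) u x
      + varDeriv₂ k i k i (L k i) u x = 0
  /-- Equations for the first derivatives in other directions. -/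
  other_first : ∀ i j k, i ≠ j → k ≠ i → k ≠ j → varDeriv₁ i j k (L i j) u x = 0
  /-- Equations for the second derivatives in other directions. -/
  other_second : ∀ i j k l, i ≠ j → k ≠ i → k ≠ j → l ≠ i → l ≠ j →
    jetPdAlong {k, l} (L i j) u x = 0
  /-- Equations for the mixed second derivatives. -/
  other_mixed : ∀ i j k l, i ≠ j → j ≠ k → k ≠ i → l ≠ i →
    jetPdAlong {j, l} (L i j) u x - jetPdAlong {k, l} (L i k) u x = 0

end LagrangianMultiform

end

/-!
The idea is to linearise the factorised identity at the solution `u`. Where all `A_{ijk}` and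
`B_{ijk}` vanish, each product `A_{ijk} B_{ijk}` has a double zero, so `d𝓛` is stationary: for every
variation `φ`, with `δL_{ij} = ∑_I (∂L_{ij}/∂u_I)[u] φ_I`,
`∂_i δL_{jk} + ∂_j δL_{ki} + ∂_k δL_{ij} = 0` on the domain of `u`.
The variations used are the plane waves `φ(y) = exp (ξ · (y - x))`. Their derivatives are
`φ_I(x) = ξ^I`, so the relation at `x` says that a polynomial in `ξ` vanishes identically, and hence
that each of its coefficients does (`linearised_closure`). Interchanging the variation with `∂_i`
is the symmetry of the second derivative of `L_{ij}` (`hasDerivAt_pd_variation`).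

The coefficients of `φ_J` with `|J| = 3` are the corner equations and the two families for second
derivatives; those with `|J| = 2` become, after substitution of these, the edge equations and the
equations for `∂L_{ij}/∂u_k`; those with `J = {k}` become the planar equations, for an auxiliary
third direction `k`, which exists because `n ≥ 3`
(`multiformEulerLagrangeAt_of_linearised_closure`).
-/

namespace LagrangianMultiform

open Filter Topology

variable {n k : ℕ} {Ω : Set (Base n)} {x : Base n}

/-! ### Partial derivatives and jets of smooth functions -/

lemma pd_congr_of_isOpen (hΩ : IsOpen Ω) (hx : x ∈ Ω) {f g : Base n → ℝ}
    (h : ∀ y ∈ Ω, f y = g y) (i : Fin n) : pd i f x = pd i g x := by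
  have : f =ᶠ[𝓝 x] g := eventually_of_mem (hΩ.mem_nhds hx) h
  rw [pd, pd, this.fderiv_eq]

lemma pd_add {f g : Base n → ℝ} (hf : DifferentiableAt ℝ f x) (hg : DifferentiableAt ℝ g x)
    (i : Fin n) : pd i (fun y => f y + g y) x = pd i f x + pd i g x := by
  simp [pd, fderiv_fun_add hf hg]

lemma pd_sub {f g : Base n → ℝ} (hf : DifferentiableAt ℝ f x) (hg : DifferentiableAt ℝ g x)
    (i : Fin n) : pd i (fun y => f y - g y) x = pd i f x - pd i g x := by
  simp [pd, fderiv_fun_sub hf hg]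

lemma pd_neg (f : Base n → ℝ) (i : Fin n) : pd i (fun y => - f y) x = - pd i f x := by
  simp [pd]

lemma pd_const_mul {f : Base n → ℝ} (hf : DifferentiableAt ℝ f x) (c : ℝ) (i : Fin n) :
    pd i (fun y => c * f y) x = c * pd i f x := by
  simp [pd, fderiv_const_mul hf]

lemma pd_sum {ι : Type*} (s : Finset ι) {f : ι → Base n → ℝ}
    (hf : ∀ a ∈ s, DifferentiableAt ℝ (f a) x) (i : Fin n) :
    pd i (fun y => ∑ a ∈ s, f a y) x = ∑ a ∈ s, pd i (f a) x := by
  simp [pd, fderiv_fun_sum hf]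

lemma contDiffOn_pd (hΩ : IsOpen Ω) {f : Base n → ℝ} (hf : ContDiffOn ℝ ∞ f Ω) (i : Fin n) :
    ContDiffOn ℝ ∞ (pd i f) Ω :=
  (hf.fderiv_of_isOpen hΩ (by simp)).clm_apply contDiffOn_const

lemma contDiffOn_foldr_pd (hΩ : IsOpen Ω) {f : Base n → ℝ} (hf : ContDiffOn ℝ ∞ f Ω)
    (l : List (Fin n)) : ContDiffOn ℝ ∞ (l.foldr pd f) Ω := by
  induction l with
  | nil => exact hf
  | cons i l ih => exact contDiffOn_pd hΩ ih i

lemma contDiffOn_jet (hΩ : IsOpen Ω) {f : Base n → ℝ} (hf : ContDiffOn ℝ ∞ f Ω) :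
    ContDiffOn ℝ ∞ (jet k f) Ω :=
  contDiffOn_id.prodMk (contDiffOn_pi.2 fun _ => contDiffOn_foldr_pd hΩ hf _)

lemma differentiableAt_of_contDiffOn (hΩ : IsOpen Ω) (hx : x ∈ Ω) {E : Type*}
    [NormedAddCommGroup E] [NormedSpace ℝ E] {f : Base n → E} (hf : ContDiffOn ℝ ∞ f Ω) :
    DifferentiableAt ℝ f x :=
  (hf.contDiffAt (hΩ.mem_nhds hx)).differentiableAt (by simp)

lemma two_le_infty : (2 : WithTop ℕ∞) ≤ ∞ := by
  exact WithTop.coe_le_coe.2 le_top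

lemma differentiableAt_fderiv_of_contDiffAt {E : Type*} [NormedAddCommGroup E] [NormedSpace ℝ E]
    {F : E → ℝ} {p : E} (hF : ContDiffAt ℝ ∞ F p) : DifferentiableAt ℝ (fderiv ℝ F) p :=
  (hF.fderiv_right (m := ∞) (by simp)).differentiableAt (by simp)

/-- The derivative of `t ↦ DF(p + t v)(w + t z)` at `t = 0`, with the two arguments of the second
derivative of `F` interchanged. -/
lemma hasDerivAt_fderiv_line {E : Type*} [NormedAddCommGroup E] [NormedSpace ℝ E]
    {F : E → ℝ} {p : E} (hF : ContDiffAt ℝ ∞ F p) (v w z : E) :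
    HasDerivAt (fun t : ℝ => fderiv ℝ F (p + t • v) (w + t • z))
      (fderiv ℝ (fderiv ℝ F) p w v + fderiv ℝ F p z) 0 := by
  have hline : ∀ a b : E, HasDerivAt (fun t : ℝ => a + t • b) b 0 := fun a b => by
    simpa using ((hasDerivAt_id (0 : ℝ)).smul_const b).const_add a
  have hF0 : HasFDerivAt (fderiv ℝ F) (fderiv ℝ (fderiv ℝ F) p) (p + (0 : ℝ) • v) := by
    simpa using (differentiableAt_fderiv_of_contDiffAt hF).hasFDerivAt
  have hF1 : HasDerivAt (fun t : ℝ => fderiv ℝ F (p + t • v)) (fderiv ℝ (fderiv ℝ F) p v) 0 :=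
    hF0.comp_hasDerivAt (0 : ℝ) (hline p v)
  have h := hF1.clm_apply (hline w z)
  simp only [zero_smul, add_zero] at h
  rwa [(hF.isSymmSndFDerivAt (by simpa using two_le_infty)).eq v w] at h

lemma fderiv_fderiv_comp_apply {E E' : Type*} [NormedAddCommGroup E] [NormedSpace ℝ E]
    [NormedAddCommGroup E'] [NormedSpace ℝ E'] {F : E → ℝ} {g : E' → E} {y : E'}
    (hF : ContDiffAt ℝ ∞ F (g y)) (hg : DifferentiableAt ℝ g y) (v : E) (w : E') :
    fderiv ℝ (fun z => fderiv ℝ F (g z) v) y w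
      = fderiv ℝ (fderiv ℝ F) (g y) (fderiv ℝ g y w) v := by
  have hF' := differentiableAt_fderiv_of_contDiffAt hF
  have h1 : DifferentiableAt ℝ (fun z => fderiv ℝ F (g z)) y := DifferentiableAt.comp y hF' hg
  have h2 : fderiv ℝ (fun z => fderiv ℝ F (g z)) y
      = (fderiv ℝ (fderiv ℝ F) (g y)).comp (fderiv ℝ g y) := fderiv_comp y hF' hg
  rw [fderiv_clm_apply h1 (differentiableAt_const _), h2]
  simp

lemma pd_comm (hΩ : IsOpen Ω) (hx : x ∈ Ω) {f : Base n → ℝ} (hf : ContDiffOn ℝ ∞ f Ω)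
    (i j : Fin n) : pd i (pd j f) x = pd j (pd i f) x := by
  have hf' := hf.contDiffAt (hΩ.mem_nhds hx)
  have h1 : DifferentiableAt ℝ (fderiv ℝ f) x :=
    differentiableAt_of_contDiffOn hΩ hx (hf.fderiv_of_isOpen hΩ (by simp))
  have key : ∀ i j : Fin n, pd i (pd j f) x
      = fderiv ℝ (fderiv ℝ f) x (Pi.single i 1) (Pi.single j 1) := by
    intro i j
    have : pd j f = fun y => fderiv ℝ f y (Pi.single j 1) := rfl
    rw [pd, this, fderiv_clm_apply h1 (differentiableAt_const _)]
    simp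
  rw [key, key]
  exact (hf'.isSymmSndFDerivAt (by simpa using two_le_infty)).eq _ _

/-- The derivative of `F` in a vertical direction (one that fixes the independent variables), in
terms of the coordinate derivatives `∂F/∂u_I`. -/
lemma fderiv_vertical_eq_sum {F : Jet n k → ℝ} (p : Jet n k) (c : MultiIndex n k → ℝ) :
    fderiv ℝ F p (0, c) = ∑ I : MultiIndex n k, c I * jetPd I.1 F p := by
  classical
  have : ((0, c) : Jet n k) = ∑ I : MultiIndex n k, c I • ((0, Pi.single I 1) : Jet n k) := by
    ext1
    · simp [Prod.fst_sum]
    · rw [Prod.snd_sum]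
      conv_lhs => rw [← Finset.univ_sum_single c]
      refine Finset.sum_congr rfl fun I _ => ?_
      simp [← Pi.single_smul]
  rw [this, map_sum]
  refine Finset.sum_congr rfl fun I _ => ?_
  rw [map_smul, jetPd, dif_pos I.2, smul_eq_mul]

lemma contDiffOn_jetPdAlong (hΩ : IsOpen Ω) {u : Base n → ℝ} (hu : ContDiffOn ℝ ∞ u Ω)
    {U : Set (Jet n k)} (hU : IsOpen U) (huU : ∀ y ∈ Ω, jet k u y ∈ U) {F : Jet n k → ℝ}
    (hF : ContDiffOn ℝ ∞ F U) (I : Multiset (Fin n)) :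
    ContDiffOn ℝ ∞ (jetPdAlong I F u) Ω := by
  unfold jetPdAlong jetPd
  split_ifs with h
  · exact ((hF.fderiv_of_isOpen hU (m := ∞) (by simp)).comp (contDiffOn_jet hΩ hu)
      huU).clm_apply contDiffOn_const
  · exact contDiffOn_const

/-! ### Variations by plane waves -/

/-- The real plane wave `y ↦ exp (ξ · (y - x))`, normalised to be `1` at `x`. -/
noncomputable def planeWave (ξ x y : Base n) : ℝ := Real.exp (∑ i, ξ i * (y i - x i))

/-- The tangent vector to the jet space whose `u_I`-component is the monomial `ξ^I`. Since
`∂_I` multiplies a plane wave by `ξ^I`, the jets of plane waves are the multiples of it. -/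
noncomputable def waveDir (k : ℕ) (ξ : Base n) : Jet n k := (0, fun I => (I.1.map ξ).prod)

@[simp] lemma planeWave_self (ξ x : Base n) : planeWave ξ x x = 1 := by simp [planeWave]

lemma contDiff_planeWave (ξ x : Base n) : ContDiff ℝ ∞ (planeWave ξ x) := by
  unfold planeWave
  fun_prop

lemma fderiv_planeWave (ξ x y : Base n) (i : Fin n) :
    fderiv ℝ (planeWave ξ x) y (Pi.single i 1) = ξ i * planeWave ξ x y := by
  have h : HasFDerivAt (fun y : Base n => ∑ i, ξ i * (y i - x i))
      (∑ i, ξ i • (ContinuousLinearMap.proj i : Base n →L[ℝ] ℝ)) y :=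
    HasFDerivAt.fun_sum fun i _ => ((hasFDerivAt_apply i y).sub_const (x i)).const_mul (ξ i)
  unfold planeWave
  rw [h.exp.fderiv]
  simp [Pi.single_apply, mul_comm]

lemma foldr_pd_add_planeWave (hΩ : IsOpen Ω) {u : Base n → ℝ} (hu : ContDiffOn ℝ ∞ u Ω)
    (ξ x : Base n) (t : ℝ) (l : List (Fin n)) : ∀ y ∈ Ω,
    l.foldr pd (fun z => u z + t * planeWave ξ x z) y
      = l.foldr pd u y + (t * (l.map ξ).prod) * planeWave ξ x y := by
  induction l with
  | nil => intro y _; simp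
  | cons i l ih =>
    intro y hy
    have he : DifferentiableAt ℝ (planeWave ξ x) y :=
      (contDiff_planeWave ξ x).differentiable (by simp) y
    rw [List.foldr_cons, pd_congr_of_isOpen hΩ hy ih,
      pd_add (differentiableAt_of_contDiffOn hΩ hy (contDiffOn_foldr_pd hΩ hu l))
        (he.const_mul _), pd_const_mul he, pd, pd, fderiv_planeWave, List.foldr_cons, pd,
      List.map_cons, List.prod_cons]
    ring

lemma jet_add_planeWave (hΩ : IsOpen Ω) {u : Base n → ℝ} (hu : ContDiffOn ℝ ∞ u Ω)
    (ξ x : Base n) (t : ℝ) {y : Base n} (hy : y ∈ Ω) :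
    jet k (fun z => u z + t * planeWave ξ x z) y
      = jet k u y + (t * planeWave ξ x y) • waveDir k ξ := by
  ext1
  · simp [jet, waveDir]
  · funext I
    have h := foldr_pd_add_planeWave hΩ hu ξ x t (I.1.sort (· ≤ ·)) y hy
    have hs : ((I.1.sort (· ≤ ·)).map ξ).prod = (I.1.map ξ).prod := by
      rw [← Multiset.prod_coe, ← Multiset.map_coe, Multiset.sort_eq]
    rw [hs] at h
    simp only [jet, pdMulti, waveDir, Prod.snd_add, Prod.smul_snd, Pi.add_apply, Pi.smul_apply,
      smul_eq_mul]
    rw [h]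
    ring

/-- The variation commutes with the total derivative `∂_i`: varying `u` by a plane wave changes
`∂_i F` by `∂_i` of the linearisation of `F` applied to the plane wave. The reason is the symmetry
of the second derivative of `F`. -/
lemma hasDerivAt_pd_variation (hΩ : IsOpen Ω) (hx : x ∈ Ω) {u : Base n → ℝ}
    (hu : ContDiffOn ℝ ∞ u Ω) {U : Set (Jet n k)} (hU : IsOpen U) (hxU : jet k u x ∈ U)
    {F : Jet n k → ℝ} (hF : ContDiffOn ℝ ∞ F U) (ξ : Base n) (i : Fin n) :
    HasDerivAt (fun t : ℝ => pd i (fun y => F (jet k (fun z => u z + t * planeWave ξ x z) y)) x)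
      (pd i (fun y => fderiv ℝ F (jet k u y) (waveDir k ξ)) x
        + ξ i * fderiv ℝ F (jet k u x) (waveDir k ξ)) 0 := by
  set v := waveDir k ξ with hv
  set p := jet k u x with hp
  set w := fderiv ℝ (jet k u) x (Pi.single i 1) with hw
  have hj : DifferentiableAt ℝ (jet k u) x :=
    differentiableAt_of_contDiffOn hΩ hx (contDiffOn_jet hΩ hu)
  have hFp := hF.contDiffAt (hU.mem_nhds hxU)
  have hcont : ContinuousAt (fun t : ℝ => p + t • v) 0 := by fun_prop
  have hmem : ∀ᶠ t in 𝓝 (0 : ℝ), p + t • v ∈ U :=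
    hcont.eventually_mem (hU.mem_nhds (by simpa using hxU))
  have he : DifferentiableAt ℝ (planeWave ξ x) x :=
    (contDiff_planeWave ξ x).differentiable (by simp) x
  -- The chain rule in the independent variables, at a fixed parameter.
  have heq : (fun t : ℝ => pd i (fun y => F (jet k (fun z => u z + t * planeWave ξ x z) y)) x)
      =ᶠ[𝓝 0] fun t => fderiv ℝ F (p + t • v) (w + t • ξ i • v) := by
    filter_upwards [hmem] with t ht
    rw [pd_congr_of_isOpen hΩ hx
      (fun y hy => by rw [jet_add_planeWave hΩ hu ξ x t hy])]
    have h1 : HasFDerivAt (fun y => jet k u y + (t * planeWave ξ x y) • v)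
        (fderiv ℝ (jet k u) x + (t • fderiv ℝ (planeWave ξ x) x).smulRight v) x :=
      hj.hasFDerivAt.add ((he.hasFDerivAt.const_mul t).smul_const v)
    have h2 : HasFDerivAt F (fderiv ℝ F (p + t • v)) (jet k u x + (t * planeWave ξ x x) • v) := by
      rw [planeWave_self, mul_one]
      exact ((hF.contDiffAt (hU.mem_nhds ht)).differentiableAt (by simp)).hasFDerivAt
    have h3 := (h2.comp x h1).fderiv
    rw [pd]
    change fderiv ℝ (F ∘ fun y => jet k u y + (t * planeWave ξ x y) • v) x _ = _
    rw [h3]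
    simp [fderiv_planeWave, hw, smul_smul]
  have hpd : pd i (fun y => fderiv ℝ F (jet k u y) v) x = fderiv ℝ (fderiv ℝ F) p w v :=
    fderiv_fderiv_comp_apply (g := jet k u) hFp hj v _
  refine HasDerivAt.congr_of_eventuallyEq ?_ heq
  rw [hpd]
  exact (hasDerivAt_fderiv_line hFp v w (ξ i • v)).congr_deriv (by rw [map_smul, smul_eq_mul])

/-! ### The exterior derivative of the Lagrangian form -/

lemma dxWedge_two_apply (p q i j : Fin n) :
    dxWedge ![p, q] ![Pi.single i (1 : ℝ), Pi.single j 1]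
      = (if p = i ∧ q = j then 1 else 0) - if p = j ∧ q = i then 1 else 0 := by
  have hperm : (Finset.univ : Finset (Equiv.Perm (Fin 2))) = {1, Equiv.swap 0 1} := by decide
  have hdet : ∀ v w : Base n, dxWedge ![p, q] ![v, w] = v p * w q - w p * v q := by
    intro v w
    rw [dxWedge, ContinuousMultilinearMap.alternatization_apply_apply, hperm,
      Finset.sum_pair (by decide)]
    simp [Fin.prod_univ_two, sub_eq_add_neg]
  rw [hdet]
  simp only [Pi.single_apply, ite_and]
  split_ifs <;> simp

/-- By antisymmetry of `L_{ij}` this holds for all `i` and `j`, not only for `i < j`. -/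
lemma lagrangianForm_apply {L : Fin n → Fin n → Jet n 2 → ℝ} {f : Base n → ℝ} {y : Base n}
    (hanti : ∀ i j, L j i (jet 2 f y) = - L i j (jet 2 f y)) (i j : Fin n) :
    lagrangianForm L f y ![Pi.single i 1, Pi.single j 1] = L i j (jet 2 f y) := by
  have hterm : ∀ p q : Fin n,
      (if p < q then L p q (jet 2 f y) • dxWedge ![p, q] else 0 : Base n [⋀^Fin 2]→L[ℝ] ℝ)
        ![Pi.single i 1, Pi.single j 1]
      = (if q = j then (if p = i then (if p < q then L p q (jet 2 f y) else 0) else 0) else 0)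
        - (if q = i then (if p = j then (if p < q then L p q (jet 2 f y) else 0) else 0)
          else 0) := by
    intro p q
    by_cases h : p < q
    · simp only [h, if_true, ContinuousAlternatingMap.smul_apply, dxWedge_two_apply, smul_eq_mul,
        mul_sub, mul_ite, mul_one, mul_zero, ← ite_and, and_comm]
    · simp [h]
  rw [lagrangianForm, ContinuousAlternatingMap.sum_apply]
  simp_rw [ContinuousAlternatingMap.sum_apply, hterm, Finset.sum_sub_distrib]
  simp only [Finset.sum_ite_eq', Finset.mem_univ, if_true]
  rcases lt_trichotomy i j with h | h | h
  · simp [h, h.not_gt]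
  · subst h
    have := hanti i i
    simp; linarith
  · simp [h, h.not_gt, hanti i j]

lemma extDeriv_lagrangianForm_apply (hΩ : IsOpen Ω) (hx : x ∈ Ω) {f : Base n → ℝ}
    (hf : ContDiffOn ℝ ∞ f Ω) {U : Set (Jet n 2)} (hU : IsOpen U) (hxU : jet 2 f x ∈ U)
    {L : Fin n → Fin n → Jet n 2 → ℝ} (hL : ∀ i j, ContDiffOn ℝ ∞ (L i j) U)
    (hanti : ∀ i j, ∀ p ∈ U, L j i p = - L i j p) (i j k : Fin n) :
    extDeriv (lagrangianForm L f) x ![Pi.single i 1, Pi.single j 1, Pi.single k 1]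
      = pd i (fun y => L j k (jet 2 f y)) x + pd j (fun y => L k i (jet 2 f y)) x
        + pd k (fun y => L i j (jet 2 f y)) x := by
  have hj : DifferentiableAt ℝ (jet 2 f) x :=
    differentiableAt_of_contDiffOn hΩ hx (contDiffOn_jet hΩ hf)
  have hLd : ∀ p q, DifferentiableAt ℝ (fun y => L p q (jet 2 f y)) x := fun p q =>
    DifferentiableAt.comp x (((hL p q).contDiffAt (hU.mem_nhds hxU)).differentiableAt (by simp)) hj
  have hd : DifferentiableAt ℝ (lagrangianForm L f) x := by
    unfold lagrangianForm
    refine DifferentiableAt.fun_sum fun p _ => DifferentiableAt.fun_sum fun q _ => ?_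
    split_ifs
    · exact (hLd p q).smul_const _
    · exact differentiableAt_const _
  have hev : ∀ᶠ y in 𝓝 x, jet 2 f y ∈ U := hj.continuousAt.eventually_mem (hU.mem_nhds hxU)
  have happ : ∀ p q : Fin n, (fun y => lagrangianForm L f y ![Pi.single p 1, Pi.single q 1])
      =ᶠ[𝓝 x] fun y => L p q (jet 2 f y) := by
    intro p q
    filter_upwards [hev] with y hy
    exact lagrangianForm_apply (fun a b => hanti a b _ hy) p q
  have hneg : (fun y => L i k (jet 2 f y)) =ᶠ[𝓝 x] fun y => - L k i (jet 2 f y) := by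
    filter_upwards [hev] with y hy
    exact hanti k i _ hy
  have e0 : (0 : Fin 3).removeNth ![(Pi.single i 1 : Base n), Pi.single j 1, Pi.single k 1]
      = ![Pi.single j 1, Pi.single k 1] := by
    ext a; fin_cases a <;> rfl
  have e1 : (1 : Fin 3).removeNth ![(Pi.single i 1 : Base n), Pi.single j 1, Pi.single k 1]
      = ![Pi.single i 1, Pi.single k 1] := by
    ext a; fin_cases a <;> rfl
  have e2 : (2 : Fin 3).removeNth ![(Pi.single i 1 : Base n), Pi.single j 1, Pi.single k 1]
      = ![Pi.single i 1, Pi.single j 1] := by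
    ext a; fin_cases a <;> rfl
  rw [extDeriv_apply hd, Fin.sum_univ_three, e0, e1, e2, (happ _ _).fderiv_eq,
    ((happ _ _).trans hneg).fderiv_eq, (happ _ _).fderiv_eq]
  simp [pd]

/-! ### Comparison of coefficients -/

lemma eval_monomial_toFinsupp (ξ : Base n) (I : Multiset (Fin n)) (c : ℝ) :
    MvPolynomial.eval ξ (MvPolynomial.monomial (Multiset.toFinsupp I) c)
      = (I.map ξ).prod * c := by
  rw [MvPolynomial.eval_monomial, Finset.prod_multiset_map_count, mul_comm]
  rfl

/-- The polynomial `∑ c_I X^I` over the multi-indices of order at most `k`. -/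
noncomputable def multiIndexPoly (k : ℕ) (c : Multiset (Fin n) → ℝ) :
    MvPolynomial (Fin n) ℝ :=
  ∑ I : MultiIndex n k, MvPolynomial.monomial (Multiset.toFinsupp I.1) (c I.1)

lemma eval_multiIndexPoly (ξ : Base n) (c : Multiset (Fin n) → ℝ) :
    MvPolynomial.eval ξ (multiIndexPoly k c)
      = ∑ I : MultiIndex n k, (I.1.map ξ).prod * c I.1 := by
  simp only [multiIndexPoly, map_sum, eval_monomial_toFinsupp]

lemma coeff_multiIndexPoly {c : Multiset (Fin n) → ℝ}
    (hc : ∀ J, ¬ Multiset.card J ≤ k → c J = 0) (J : Multiset (Fin n)) :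
    MvPolynomial.coeff (Multiset.toFinsupp J) (multiIndexPoly k c) = c J := by
  classical
  simp only [multiIndexPoly, MvPolynomial.coeff_sum, MvPolynomial.coeff_monomial,
    EmbeddingLike.apply_eq_iff_eq]
  by_cases hJ : Multiset.card J ≤ k
  · rw [Finset.sum_eq_single (⟨J, hJ⟩ : MultiIndex n k)]
    · simp
    · intro I _ hI
      exact if_neg fun h => hI (Subtype.ext h)
    · simp
  · rw [hc J hJ]
    refine Finset.sum_eq_zero fun I _ => if_neg ?_
    rintro rfl
    exact hJ I.2

lemma coeff_X_mul_multiIndexPoly {c : Multiset (Fin n) → ℝ}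
    (hc : ∀ J, ¬ Multiset.card J ≤ k → c J = 0) (i : Fin n) (J : Multiset (Fin n)) :
    MvPolynomial.coeff (Multiset.toFinsupp J) (MvPolynomial.X i * multiIndexPoly k c)
      = if i ∈ J then c (J.erase i) else 0 := by
  classical
  have h : Multiset.toFinsupp J - Finsupp.single i 1 = Multiset.toFinsupp (J.erase i) := by
    ext a
    by_cases ha : a = i
    · subst ha; simp
    · simp [ha]
  rw [MvPolynomial.coeff_X_mul', h, coeff_multiIndexPoly hc]
  simp

/-- If `∑_a (∑_I b_I^a ξ^I + ξ_{i_a} ∑_I c_I^a ξ^I)` vanishes for all real `ξ`, then so does the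
coefficient of every monomial `ξ^J`. -/
lemma coeff_eq_zero_of_forall_eval {ι : Type*} [Fintype ι] (i : ι → Fin n)
    {b c : ι → Multiset (Fin n) → ℝ} (hb : ∀ a J, ¬ Multiset.card J ≤ k → b a J = 0)
    (hc : ∀ a J, ¬ Multiset.card J ≤ k → c a J = 0)
    (h : ∀ ξ : Base n, ∑ a, (∑ I : MultiIndex n k, (I.1.map ξ).prod * b a I.1
      + ξ (i a) * ∑ I : MultiIndex n k, (I.1.map ξ).prod * c a I.1) = 0)
    (J : Multiset (Fin n)) :
    ∑ a, (b a J + if i a ∈ J then c a (J.erase (i a)) else 0) = 0 := by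
  have hp : ∑ a, (multiIndexPoly k (b a) + MvPolynomial.X (i a) * multiIndexPoly k (c a)) = 0 := by
    refine MvPolynomial.funext fun ξ => ?_
    simpa [eval_multiIndexPoly] using h ξ
  have := congrArg (MvPolynomial.coeff (Multiset.toFinsupp J)) hp
  simpa only [MvPolynomial.coeff_sum, MvPolynomial.coeff_add, coeff_multiIndexPoly (hb _),
    coeff_X_mul_multiIndexPoly (hc _), MvPolynomial.coeff_zero] using this

/-! ### The coefficients of the linearised form -/

lemma jetPdAlong_eq_zero {I : Multiset (Fin n)} (hI : ¬ Multiset.card I ≤ k) (F : Jet n k → ℝ)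
    (u : Base n → ℝ) : jetPdAlong I F u = fun _ => 0 := by
  funext y
  rw [jetPdAlong, jetPd, dif_neg hI]

lemma jetPdAlong_neg {U : Set (Jet n k)} (hU : IsOpen U) {u : Base n → ℝ}
    (hxU : jet k u x ∈ U) {F G : Jet n k → ℝ} (h : ∀ p ∈ U, G p = - F p)
    (I : Multiset (Fin n)) : jetPdAlong I G u x = - jetPdAlong I F u x := by
  have hev : G =ᶠ[𝓝 (jet k u x)] fun p => - F p := eventually_of_mem (hU.mem_nhds hxU) h
  unfold jetPdAlong jetPd
  split_ifs
  · rw [hev.fderiv_eq, fderiv_fun_neg]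
    rfl
  · simp

lemma fderiv_waveDir (F : Jet n k → ℝ) (u : Base n → ℝ) (y ξ : Base n) :
    fderiv ℝ F (jet k u y) (waveDir k ξ)
      = ∑ I : MultiIndex n k, (I.1.map ξ).prod * jetPdAlong I.1 F u y :=
  fderiv_vertical_eq_sum _ _

lemma pd_fderiv_waveDir (hΩ : IsOpen Ω) (hx : x ∈ Ω) {u : Base n → ℝ}
    (hu : ContDiffOn ℝ ∞ u Ω) {U : Set (Jet n k)} (hU : IsOpen U)
    (huU : ∀ y ∈ Ω, jet k u y ∈ U) {F : Jet n k → ℝ} (hF : ContDiffOn ℝ ∞ F U)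
    (ξ : Base n) (i : Fin n) :
    pd i (fun y => fderiv ℝ F (jet k u y) (waveDir k ξ)) x
      = ∑ I : MultiIndex n k, (I.1.map ξ).prod * pd i (jetPdAlong I.1 F u) x := by
  have hd : ∀ I : MultiIndex n k, DifferentiableAt ℝ (jetPdAlong I.1 F u) x := fun I =>
    differentiableAt_of_contDiffOn hΩ hx (contDiffOn_jetPdAlong hΩ hu hU huU hF I.1)
  simp only [fderiv_waveDir]
  rw [pd_sum _ fun I _ => (hd I).const_mul _]
  exact Finset.sum_congr rfl fun I _ => pd_const_mul (hd I) _ i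

/-- The product of two functions that vanish at `t = 0` vanishes there to second order. -/
lemma hasDerivAt_mul_of_eq_zero {a b : ℝ → ℝ} (ha : DifferentiableAt ℝ a 0)
    (hb : DifferentiableAt ℝ b 0) (ha0 : a 0 = 0) (hb0 : b 0 = 0) :
    HasDerivAt (fun t => a t * b t) 0 0 :=
  (ha.hasDerivAt.mul hb.hasDerivAt).congr_deriv (by simp [ha0, hb0])

/-- On a common zero of all `A_{ijk}` and `B_{ijk}` the products `A_{ijk} B_{ijk}` have a double
zero, so the variation of `d𝓛` vanishes; these are the coefficients of `φ_J` in
`∂_i δL_{jk} + ∂_j δL_{ki} + ∂_k δL_{ij} = 0`, where `δL_{ij} = ∑_I ∂L_{ij}/∂u_I φ_I`. -/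
lemma linearised_closure {m : ℕ} {U : Set (Jet n 2)} (hU : IsOpen U)
    {W : Set (Jet n m)} (hW : IsOpen W) {L : Fin n → Fin n → Jet n 2 → ℝ}
    (hL : ∀ i j, ContDiffOn ℝ ∞ (L i j) U) (hanti : ∀ i j, ∀ p ∈ U, L j i p = - L i j p)
    {A B : Fin n → Fin n → Fin n → Jet n m → ℝ}
    (hA : ∀ i j k, i < j → j < k → ContDiffOn ℝ ∞ (A i j k) W)
    (hB : ∀ i j k, i < j → j < k → ContDiffOn ℝ ∞ (B i j k) W)
    (hfact : Factorises U W L A B) (hΩ : IsOpen Ω) {u : Base n → ℝ} (hu : ContDiffOn ℝ ∞ u Ω)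
    (huU : ∀ y ∈ Ω, jet 2 u y ∈ U) (hx : x ∈ Ω) (hxW : jet m u x ∈ W)
    (hA0 : ∀ i j k, i < j → j < k → A i j k (jet m u x) = 0)
    (hB0 : ∀ i j k, i < j → j < k → B i j k (jet m u x) = 0)
    (i j k : Fin n) (J : Multiset (Fin n)) :
    (pd i (jetPdAlong J (L j k) u) x
        + if i ∈ J then jetPdAlong (J.erase i) (L j k) u x else 0)
      + (pd j (jetPdAlong J (L k i) u) x
        + if j ∈ J then jetPdAlong (J.erase j) (L k i) u x else 0)
      + (pd k (jetPdAlong J (L i j) u) x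
        + if k ∈ J then jetPdAlong (J.erase k) (L i j) u x else 0) = 0 := by
  have hzero : ∀ (p : Fin n) (F : Jet n 2 → ℝ) (I : Multiset (Fin n)),
      ¬ Multiset.card I ≤ 2 → pd p (jetPdAlong I F u) x = 0 := fun p F I hI => by
    rw [jetPdAlong_eq_zero hI]; simp [pd]
  have key := coeff_eq_zero_of_forall_eval (k := 2) ![i, j, k]
    (b := fun a I => pd (![i, j, k] a) (jetPdAlong I (![L j k, L k i, L i j] a) u) x)
    (c := fun a I => jetPdAlong I (![L j k, L k i, L i j] a) u x)
    (fun a I hI => hzero _ _ I hI) (fun a I hI => by rw [jetPdAlong_eq_zero hI]) ?_ J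
  · rw [Fin.sum_univ_three] at key
    exact key
  intro ξ
  -- The variation `u + t φ` by the plane wave `φ` with frequency `ξ`.
  set f : ℝ → Base n → ℝ := fun t z => u z + t * planeWave ξ x z with hf
  have hfs : ∀ t, ContDiffOn ℝ ∞ (f t) Ω := fun t =>
    hu.add (contDiff_const.mul (contDiff_planeWave ξ x)).contDiffOn
  have hjet : ∀ (l : ℕ) (t : ℝ), jet l (f t) x = jet l u x + t • waveDir l ξ := fun l t => by
    rw [hf, jet_add_planeWave hΩ hu ξ x t hx, planeWave_self, mul_one]
  have hline : ∀ l : ℕ, DifferentiableAt ℝ (fun t : ℝ => jet l u x + t • waveDir l ξ) 0 :=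
    fun l => (differentiableAt_id.smul_const _).const_add _
  have hmemU : ∀ᶠ t in 𝓝 (0 : ℝ), jet 2 (f t) x ∈ U := by
    simp only [hjet]
    exact (hline 2).continuousAt.eventually_mem (hU.mem_nhds (by simpa using huU x hx))
  have hmemW : ∀ᶠ t in 𝓝 (0 : ℝ), jet m (f t) x ∈ W := by
    simp only [hjet]
    exact (hline m).continuousAt.eventually_mem (hW.mem_nhds (by simpa using hxW))
  set e : Fin 3 → Base n := ![Pi.single i 1, Pi.single j 1, Pi.single k 1] with he
  -- The right-hand side of the factorisation has derivative zero in `t`.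
  have hR : HasDerivAt (fun t : ℝ => ∑ p : Fin n, ∑ q : Fin n, ∑ r : Fin n,
      if p < q ∧ q < r then
        A p q r (jet m (f t) x) * B p q r (jet m (f t) x) * dxWedge ![p, q, r] e
      else 0) 0 0 := by
    have hcomp : ∀ G : Jet n m → ℝ, ContDiffOn ℝ ∞ G W →
        DifferentiableAt ℝ (fun t => G (jet m (f t) x)) 0 := fun G hG => by
      simp only [hjet]
      refine DifferentiableAt.comp (0 : ℝ) ?_ (hline m)
      exact (hG.contDiffAt (hW.mem_nhds (by simpa using hxW))).differentiableAt (by simp)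
    have hterm : ∀ p q r : Fin n, HasDerivAt (fun t : ℝ => if p < q ∧ q < r then
        A p q r (jet m (f t) x) * B p q r (jet m (f t) x) * dxWedge ![p, q, r] e
        else 0) 0 0 := by
      intro p q r
      split_ifs with h
      · have h0 : jet m (f 0) x = jet m u x := by simp [hjet]
        refine ((hasDerivAt_mul_of_eq_zero (hcomp _ (hA p q r h.1 h.2))
          (hcomp _ (hB p q r h.1 h.2)) ?_ ?_).mul_const _).congr_deriv (zero_mul _)
        · rw [h0, hA0 p q r h.1 h.2]
        · rw [h0, hB0 p q r h.1 h.2]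
      · exact hasDerivAt_const _ _
    refine (HasDerivAt.fun_sum fun p _ => HasDerivAt.fun_sum fun q _ =>
      HasDerivAt.fun_sum fun r _ => hterm p q r).congr_deriv (by simp)
  -- By the factorisation it equals the cyclic sum of `∂_i L_{jk}` near `t = 0`.
  have hLR : (fun t : ℝ => pd i (fun y => L j k (jet 2 (f t) y)) x
      + pd j (fun y => L k i (jet 2 (f t) y)) x + pd k (fun y => L i j (jet 2 (f t) y)) x)
      =ᶠ[𝓝 0] fun t : ℝ => ∑ p : Fin n, ∑ q : Fin n, ∑ r : Fin n,
      if p < q ∧ q < r then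
        A p q r (jet m (f t) x) * B p q r (jet m (f t) x) * dxWedge ![p, q, r] e
      else 0 := by
    filter_upwards [hmemU, hmemW] with t htU htW
    rw [← extDeriv_lagrangianForm_apply hΩ hx (hfs t) hU htU hL hanti i j k,
      hfact Ω (f t) hΩ (hfs t) x hx htU htW]
    simp only [ContinuousAlternatingMap.sum_apply]
    refine Finset.sum_congr rfl fun p _ => Finset.sum_congr rfl fun q _ =>
      Finset.sum_congr rfl fun r _ => ?_
    split_ifs
    · rfl
    · rfl
  have hvar : ∀ (F : Jet n 2 → ℝ), ContDiffOn ℝ ∞ F U → ∀ p : Fin n,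
      HasDerivAt (fun t : ℝ => pd p (fun y => F (jet 2 (f t) y)) x)
        (∑ I : MultiIndex n 2, (I.1.map ξ).prod * pd p (jetPdAlong I.1 F u) x
          + ξ p * ∑ I : MultiIndex n 2, (I.1.map ξ).prod * jetPdAlong I.1 F u x) 0 := by
    intro F hF p
    rw [← pd_fderiv_waveDir hΩ hx hu hU huU hF, ← fderiv_waveDir]
    exact hasDerivAt_pd_variation hΩ hx hu hU (huU x hx) hF ξ p
  have huniq := (((hvar _ (hL j k) i).add (hvar _ (hL k i) j)).add (hvar _ (hL i j) k)).unique
    (hR.congr_of_eventuallyEq hLR)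
  rw [Fin.sum_univ_three]
  exact huniq

/-! ### From the linearised closure relation to the Euler–Lagrange equations -/

/-- The multiform Euler–Lagrange equations are differential consequences of the vanishing of the
coefficients of the linearised closure relation. -/
lemma multiformEulerLagrangeAt_of_linearised_closure (hn : 3 ≤ n) (hΩ : IsOpen Ω)
    {L : Fin n → Fin n → Jet n 2 → ℝ} {u : Base n → ℝ}
    (hsmooth : ∀ i j I, ContDiffOn ℝ ∞ (jetPdAlong I (L i j) u) Ω)
    (hanti : ∀ i j I, ∀ y ∈ Ω, jetPdAlong I (L j i) u y = - jetPdAlong I (L i j) u y)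
    (hE : ∀ y ∈ Ω, ∀ (i j k : Fin n) (J : Multiset (Fin n)),
      (pd i (jetPdAlong J (L j k) u) y
        + if i ∈ J then jetPdAlong (J.erase i) (L j k) u y else 0)
      + (pd j (jetPdAlong J (L k i) u) y
        + if j ∈ J then jetPdAlong (J.erase j) (L k i) u y else 0)
      + (pd k (jetPdAlong J (L i j) u) y
        + if k ∈ J then jetPdAlong (J.erase k) (L i j) u y else 0) = 0)
    (hx : x ∈ Ω) : MultiformEulerLagrangeAt L u x := by
  -- `a i j I` is the coefficient of `φ_I` in the linearisation of `L_{ij}`.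
  set a : Fin n → Fin n → Multiset (Fin n) → Base n → ℝ :=
    fun i j I => jetPdAlong I (L i j) u with ha
  have ha3 : ∀ i j I, ¬ Multiset.card I ≤ 2 → ∀ p y, pd p (a i j I) y = 0 := by
    intro i j I hI p y
    simp only [ha, jetPdAlong_eq_zero hI]
    simp [pd]
  have hd : ∀ i j I, ∀ y ∈ Ω, DifferentiableAt ℝ (a i j I) y := fun i j I y hy =>
    differentiableAt_of_contDiffOn hΩ hy (hsmooth i j I)
  have hd' : ∀ p i j I, ∀ y ∈ Ω, DifferentiableAt ℝ (pd p (a i j I)) y := fun p i j I y hy =>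
    differentiableAt_of_contDiffOn hΩ hy (contDiffOn_pd hΩ (hsmooth i j I) p)
  have hanti1 : ∀ p i j I, ∀ y ∈ Ω, pd p (a j i I) y = - pd p (a i j I) y := by
    intro p i j I y hy
    rw [pd_congr_of_isOpen hΩ hy (hanti i j I), pd_neg]
  have hanti2 : ∀ q p i j I, ∀ y ∈ Ω, pd q (pd p (a j i I)) y = - pd q (pd p (a i j I)) y := by
    intro q p i j I y hy
    rw [pd_congr_of_isOpen hΩ hy (hanti1 p i j I), pd_neg]
  -- The coefficients of the third derivatives.
  have second : ∀ y ∈ Ω, ∀ i j k l, i ≠ j → k ≠ i → k ≠ j → l ≠ i → l ≠ j →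
      a i j {k, l} y = 0 := by
    intro y hy i j k l hij hki hkj hli hlj
    have h := hE y hy i j k {k, k, l}
    have hi : i ∉ ({k, k, l} : Multiset (Fin n)) := by simp [hki.symm, hli.symm]
    have hj : j ∉ ({k, k, l} : Multiset (Fin n)) := by simp [hkj.symm, hlj.symm]
    have hk : k ∈ ({k, k, l} : Multiset (Fin n)) := by simp
    have ek : ({k, k, l} : Multiset (Fin n)).erase k = {k, l} := by simp
    rw [if_neg hi, if_neg hj, if_pos hk, ek] at h
    have := ha3 j k {k, k, l} (by simp) i y
    have := ha3 k i {k, k, l} (by simp) j y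
    have := ha3 i j {k, k, l} (by simp) k y
    simp only [ha] at *
    linarith
  have mixed : ∀ i j k l, i ≠ j → j ≠ k → k ≠ i → l ≠ i → ∀ y ∈ Ω,
      a i j {j, l} y = a i k {k, l} y := by
    intro i j k l hij hjk hki hli y hy
    have h := hE y hy i j k {j, k, l}
    have hi : i ∉ ({j, k, l} : Multiset (Fin n)) := by simp [hij, hki.symm, hli.symm]
    have hj : j ∈ ({j, k, l} : Multiset (Fin n)) := by simp
    have hk : k ∈ ({j, k, l} : Multiset (Fin n)) := by simp
    have ej : ({j, k, l} : Multiset (Fin n)).erase j = {k, l} := by simp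
    have ek : ({j, k, l} : Multiset (Fin n)).erase k = {j, l} := by
      simp [Multiset.erase_cons_tail, hjk]
    rw [if_neg hi, if_pos hj, if_pos hk, ej, ek] at h
    have := ha3 j k {j, k, l} (by simp) i y
    have := ha3 k i {j, k, l} (by simp) j y
    have := ha3 i j {j, k, l} (by simp) k y
    have := hanti i k {k, l} y hy
    simp only [ha] at *
    linarith
  have corner : ∀ i j k, i ≠ j → j ≠ k → k ≠ i → ∀ y ∈ Ω,
      a i j {i, j} y + a j k {j, k} y + a k i {k, i} y = 0 := by
    intro i j k hij hjk hki y hy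
    have h := hE y hy i j k {i, j, k}
    have ei : ({i, j, k} : Multiset (Fin n)).erase i = {j, k} := by simp
    have ej : ({i, j, k} : Multiset (Fin n)).erase j = {k, i} := by
      rw [Multiset.pair_comm k i]
      simp [Multiset.erase_cons_tail, hij]
    have ek : ({i, j, k} : Multiset (Fin n)).erase k = {i, j} := by
      simp [Multiset.erase_cons_tail, hjk, hki.symm]
    rw [if_pos (by simp), if_pos (by simp), if_pos (by simp), ei, ej, ek] at h
    have := ha3 j k {i, j, k} (by simp) i y
    have := ha3 k i {i, j, k} (by simp) j y
    have := ha3 i j {i, j, k} (by simp) k y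
    simp only [ha] at *
    linarith
  -- The coefficients of the second derivatives.
  have first : ∀ i j k, i ≠ j → k ≠ i → k ≠ j → ∀ y ∈ Ω,
      a i j {k} y - pd i (a i j {i, k}) y - pd j (a i j {j, k}) y = 0 := by
    intro i j k hij hki hkj y hy
    have h := hE y hy i j k {k, k}
    have hi : i ∉ ({k, k} : Multiset (Fin n)) := by simp [hki.symm]
    have hj : j ∉ ({k, k} : Multiset (Fin n)) := by simp [hkj.symm]
    have hk : k ∈ ({k, k} : Multiset (Fin n)) := by simp
    have ek : ({k, k} : Multiset (Fin n)).erase k = {k} := by simp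
    rw [if_neg hi, if_neg hj, if_pos hk, ek] at h
    have h0 : pd k (a i j {k, k}) y = 0 := by
      rw [pd_congr_of_isOpen hΩ hy fun z hz => second z hz i j k k hij hki hkj hki hkj]
      simp [pd]
    have h1 := pd_congr_of_isOpen hΩ hy (mixed j i k k hij.symm hki.symm hkj hkj) i
    have h2 := pd_congr_of_isOpen hΩ hy (mixed i j k k hij hkj.symm hki hki) j
    have h3 := hanti1 i i j {i, k} y hy
    have h4 := hanti1 j i k {k, k} y hy
    simp only [ha] at *
    linarith
  have edge : ∀ i j k, i ≠ j → j ≠ k → k ≠ i → ∀ y ∈ Ω,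
      a i j {j} y - pd i (a i j {i, j}) y - pd j (a i j {j, j}) y
        - (a i k {k} y - pd i (a i k {i, k}) y - pd k (a i k {k, k}) y) = 0 := by
    intro i j k hij hjk hki y hy
    have h := hE y hy i j k {j, k}
    have hi : i ∉ ({j, k} : Multiset (Fin n)) := by simp [hij, hki.symm]
    have ej : ({j, k} : Multiset (Fin n)).erase j = {k} := by simp
    have ek : ({j, k} : Multiset (Fin n)).erase k = {j} := by
      simp [Multiset.erase_cons_tail, hjk]
    rw [if_neg hi, if_pos (by simp), if_pos (by simp), ej, ek] at h
    have h1 : pd i (a i j {i, j}) y + pd i (a j k {j, k}) y + pd i (a k i {k, i}) y = 0 := by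
      rw [← pd_add (hd _ _ _ y hy) (hd _ _ _ y hy),
        ← pd_add ((hd _ _ _ y hy).fun_add (hd _ _ _ y hy)) (hd _ _ _ y hy),
        pd_congr_of_isOpen hΩ hy (corner i j k hij hjk hki)]
      simp [pd]
    have h2 := pd_congr_of_isOpen hΩ hy (mixed i j k j hij hjk hki hij.symm) j
    have h3 := pd_congr_of_isOpen hΩ hy (mixed i j k k hij hjk hki hki) k
    have h4 := hanti1 j i k {k, j} y hy
    have h5 := hanti1 i i k {k, i} y hy
    have h6 := hanti i k {k} y hy
    rw [Multiset.pair_comm k j] at h2 h4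
    rw [Multiset.pair_comm k i] at h1 h5
    simp only [ha] at *
    linarith
  -- The coefficient of the first derivative in a third direction.
  have planar : ∀ i j, i ≠ j → a i j 0 x - pd i (a i j {i}) x - pd j (a i j {j}) x
      + pd i (pd i (a i j {i, i})) x + pd i (pd j (a i j {i, j})) x
      + pd j (pd j (a i j {j, j})) x = 0 := by
    intro i j hij
    obtain ⟨k, hki, hkj⟩ : ∃ k : Fin n, k ≠ i ∧ k ≠ j := by
      have hcard : ({i, j} : Finset (Fin n)).card < Fintype.card (Fin n) := by
        rw [Finset.card_pair hij, Fintype.card_fin]; omega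
      obtain ⟨k, hk⟩ := Finset.exists_mem_notMem_of_card_lt_card
        (s := {i, j}) (t := Finset.univ) (by simpa using hcard)
      exact ⟨k, by simpa using hk⟩
    have h := hE x hx i j k {k}
    have hi : i ∉ ({k} : Multiset (Fin n)) := by simp [hki.symm]
    have hj : j ∉ ({k} : Multiset (Fin n)) := by simp [hkj.symm]
    have ek : ({k} : Multiset (Fin n)).erase k = 0 := by simp
    rw [if_neg hi, if_neg hj, if_pos (by simp), ek] at h
    have hsix : ∀ (p i j k : Fin n), i ≠ j → j ≠ k → k ≠ i →
        pd p (a i j {j}) x - pd p (pd i (a i j {i, j})) x - pd p (pd j (a i j {j, j})) x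
        - (pd p (a i k {k}) x - pd p (pd i (a i k {i, k})) x
          - pd p (pd k (a i k {k, k})) x) = 0 := by
      intro p i j k hij hjk hki
      have e : ∀ j, DifferentiableAt ℝ (a i j {j}) x := fun j => hd _ _ _ x hx
      have e1 : ∀ j, DifferentiableAt ℝ (pd i (a i j {i, j})) x := fun j => hd' _ _ _ _ x hx
      have e2 : ∀ j, DifferentiableAt ℝ (pd j (a i j {j, j})) x := fun j => hd' _ _ _ _ x hx
      rw [← pd_sub (e j) (e1 j), ← pd_sub ((e j).fun_sub (e1 j)) (e2 j), ← pd_sub (e k) (e1 k),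
        ← pd_sub ((e k).fun_sub (e1 k)) (e2 k),
        ← pd_sub (((e j).fun_sub (e1 j)).fun_sub (e2 j)) (((e k).fun_sub (e1 k)).fun_sub (e2 k)),
        pd_congr_of_isOpen hΩ hx (edge i j k hij hjk hki)]
      simp [pd]
    -- `∂_i`, `∂_j`, `∂_k` of the lower-order equations eliminate the coefficients that
    -- involve `k`.
    have h1 := hsix i j i k hij.symm hki.symm hkj
    have h2 := hsix j i j k hij hkj.symm hki
    have h3 : pd k (a i j {k}) x - pd k (pd i (a i j {i, k})) x
        - pd k (pd j (a i j {j, k})) x = 0 := by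
      rw [← pd_sub (hd _ _ _ x hx) (hd' _ _ _ _ x hx),
        ← pd_sub ((hd _ _ _ x hx).fun_sub (hd' _ _ _ _ x hx)) (hd' _ _ _ _ x hx),
        pd_congr_of_isOpen hΩ hx (first i j k hij hki hkj)]
      simp [pd]
    have h4 : pd i (pd j (a i j {i, j})) x + pd i (pd j (a j k {j, k})) x
        + pd i (pd j (a k i {k, i})) x = 0 := by
      rw [← pd_add (hd' _ _ _ _ x hx) (hd' _ _ _ _ x hx),
        ← pd_add ((hd' _ _ _ _ x hx).fun_add (hd' _ _ _ _ x hx)) (hd' _ _ _ _ x hx),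
        pd_congr_of_isOpen hΩ hx (g := fun _ => 0)]
      · simp [pd]
      · intro y hy
        rw [← pd_add (hd _ _ _ y hy) (hd _ _ _ y hy),
          ← pd_add ((hd _ _ _ y hy).fun_add (hd _ _ _ y hy)) (hd _ _ _ y hy),
          pd_congr_of_isOpen hΩ hy (corner i j k hij hkj.symm hki)]
        simp [pd]
    have h5 := pd_congr_of_isOpen hΩ hx (fun y hy =>
      pd_congr_of_isOpen hΩ hy (mixed j i k k hij.symm hki.symm hkj hkj) i) k
    have h6 := pd_congr_of_isOpen hΩ hx (fun y hy =>
      pd_congr_of_isOpen hΩ hy (mixed i j k k hij hkj.symm hki hki) j) k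
    have c1 := pd_comm hΩ hx (hsmooth j k {k, k}) i k
    have c2 := pd_comm hΩ hx (hsmooth i k {k, k}) j k
    have c3 := pd_comm hΩ hx (hsmooth i j {i, j}) i j
    have c4 := pd_comm hΩ hx (hsmooth i k {i, k}) i j
    have s1 := hanti1 i i j {i} x hx
    have s2 := hanti2 i j i j {j, i} x hx
    have s3 := hanti2 i i i j {i, i} x hx
    have s4 := hanti2 k i i j {i, k} x hx
    have s5 := hanti1 j i k {k} x hx
    have s6 := hanti2 i j i k {k, i} x hx
    rw [Multiset.pair_comm j i] at s2 h1
    rw [Multiset.pair_comm k i] at s6 h4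
    simp only [ha] at *
    linarith
  exact
    { planar := planar
      edge := fun i j k hij hjk hki => edge i j k hij hjk hki x hx
      corner := fun i j k hij hjk hki => corner i j k hij hjk hki x hx
      other_first := fun i j k hij hki hkj => first i j k hij hki hkj x hx
      other_second := second x hx
      other_mixed := fun i j k l hij hjk hki hli =>
        sub_eq_zero.2 (mixed i j k l hij hjk hki hli x hx) }

end LagrangianMultiform

theorem theorem1 {n m : ℕ} (hn : 3 ≤ n)
    (U : Set (LagrangianMultiform.Jet n 2)) (hU : IsOpen U)
    (W : Set (LagrangianMultiform.Jet n m)) (hW : IsOpen W)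
    (L : Fin n → Fin n → LagrangianMultiform.Jet n 2 → ℝ)
    (hL : ∀ i j, ContDiffOn ℝ ∞ (L i j) U)
    (hLanti : ∀ i j, ∀ p ∈ U, L j i p = - L i j p)
    (A B : Fin n → Fin n → Fin n → LagrangianMultiform.Jet n m → ℝ)
    (hA : ∀ i j k, i < j → j < k → ContDiffOn ℝ ∞ (A i j k) W)
    (hB : ∀ i j k, i < j → j < k → ContDiffOn ℝ ∞ (B i j k) W)
    (hfact : LagrangianMultiform.Factorises U W L A B)
    (Ω : Set (LagrangianMultiform.Base n)) (hΩ : IsOpen Ω)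
    (u : LagrangianMultiform.Base n → ℝ) (hu : ContDiffOn ℝ ∞ u Ω)
    (huU : ∀ x ∈ Ω, LagrangianMultiform.jet 2 u x ∈ U)
    (huW : ∀ x ∈ Ω, LagrangianMultiform.jet m u x ∈ W)
    (hAzero : ∀ x ∈ Ω, ∀ i j k, i < j → j < k → A i j k (LagrangianMultiform.jet m u x) = 0)
    (hBzero : ∀ x ∈ Ω, ∀ i j k, i < j → j < k → B i j k (LagrangianMultiform.jet m u x) = 0) :
    ∀ x ∈ Ω, LagrangianMultiform.MultiformEulerLagrangeAt L u x := by
  intro x hx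
  refine LagrangianMultiform.multiformEulerLagrangeAt_of_linearised_closure hn hΩ
    (fun i j I => LagrangianMultiform.contDiffOn_jetPdAlong hΩ hu hU huU (hL i j) I)
    (fun i j I y hy => LagrangianMultiform.jetPdAlong_neg hU (huU y hy) (hLanti i j) I)
    (fun y hy i j k J => ?_) hx
  exact LagrangianMultiform.linearised_closure hU hW hL hLanti hA hB hfact hΩ hu huU hy
    (huW y hy) (hAzero y hy) (hBzero y hy) i j k J
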